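/- For $n\in\{2,3\}$ let $n^\omega$ be the space of infinite sequences over $\{0,\dots,n-1\}$ with the product topology, and let $\lambda$ be Lebesgue measure on it, so that $\lambda(\llbracket\sigma\rrbracket)=n^{-|\sigma|}$, where $\llbracket\sigma\rrbracket$ is the set of sequences extending the finite string $\sigma$. For a sequence $z$ over a finite alphabet, a $\lambda$-Martin-Löf test relative to $z$ is a sequence $(U_i)_{i\in\omega}$ of subsets of $n^\omega$ that is uniformly $\Sigma^{0,z}_1$ (that is, $U_i=\bigcup_{(i,\sigma)\in W}\llbracket\sigma\rrbracket$ for some set $W$ of pairs that is computably enumerable with oracle $z$) with $\lambda(U_i)\le 2^{-i}$ for all $i$. A sequence is $\lambda$-Martin-Löf random relative to $z$ if it lies in $\bigcap_i U_i$ for no such test, and $\lambda$-Martin-Löf random if this holds without an oracle. Let $\sigma_0=\epsilon,\sigma_1=0,\sigma_2=1,\sigma_3=00,\dots$ be the length-lexicographic enumeration of the finite binary strings. Each $x\in 3^\omega$ labels the non-empty strings by $\ell_x(\sigma_i)=x(i-1)$, and codes the partial function $F_x\colon\subseteq 2^\omega\to 2^\omega$ for which $F_x(y)$ is the result of deleting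 all $2$'s from the sequence $\ell_x(y\restriction 1),\ell_x(y\restriction 2),\dots$, undefined if only finitely many letters remain. A random continuous function is a partial function $F\colon\subseteq 2^\omega\to2^\omega$ with $F=F_x$ for some $\lambda$-Martin-Löf random $x\in 3^\omega$. **Theorem.** If $F$ is a random continuous function, then its range $\mathrm{ran}(F)$ is a measurable set of positive Lebesgue measure, $\lambda(\mathrm{ran}(F))>0$. Moreover, $\mathrm{ran}(F)$ contains a real that is $\lambda$-random relative to $F$: for every code $x\in3^\omega$ of $F$ (that is, every $x$ with $F_x=F$) there is $y\in\mathrm{ran}(F)$ that is $\lambda$-Martin-Löf random relative to $x$. -/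

import Mathlib

open MeasureTheory
open scoped ENNReal

/-- The space `n^ω` of infinite sequences over the alphabet `{0, …, n-1}`, with the product
`σ`-algebra, which is its Borel `σ`-algebra. -/
abbrev OmegaSeq (n : ℕ) : Type := ℕ → Fin n

/-- The initial segment `x ↾ k` of length `k`. -/
def OmegaSeq.initSeg {n : ℕ} (x : OmegaSeq n) (k : ℕ) : List (Fin n) :=
  (List.range k).map x

/-- The basic clopen set `⟦σ⟧` of all sequences that extend the string `σ`. -/
def cyl {n : ℕ} (σ : List (Fin n)) : Set (OmegaSeq n) :=
  {x | x.initSeg σ.length = σ}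

/-- Lebesgue measure on `n^ω`: the product of the uniform measures, so `λ ⟦σ⟧ = n^(-|σ|)`. -/
noncomputable def lebesgue (n : ℕ) [NeZero n] : Measure (OmegaSeq n) :=
  Measure.infinitePi fun _ => (PMF.uniformOfFintype (Fin n)).toMeasure

/-- `p` is computably enumerable relative to the oracles in `O`. For `O = ∅` this is, by
`recursiveIn_empty_iff`, the same as `REPred p`. -/
def REIn {α : Type*} [Primcodable α] (O : Set (ℕ →. ℕ)) (p : α → Prop) : Prop :=
  RecursiveIn O fun a => Part.assert (p a) fun _ => Part.some ()

/-- The sequence `z`, as an oracle. -/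
def OmegaSeq.oracle {m : ℕ} (z : OmegaSeq m) : ℕ →. ℕ :=
  fun k => Part.some (z k : ℕ)

/-- `U` is a uniformly `Σ⁰₁` sequence of subsets of `n^ω` relative to `O`: the sets `U i` are
unions of basic clopen sets, enumerated uniformly in `i` by an algorithm with oracles in `O`. -/
def UniformSigma01 {n : ℕ} (O : Set (ℕ →. ℕ)) (U : ℕ → Set (OmegaSeq n)) : Prop :=
  ∃ W : ℕ × List (Fin n) → Prop, REIn O W ∧ ∀ i, U i = ⋃ σ ∈ {σ | W (i, σ)}, cyl σ

/-- `U` is a Martin-Löf test for `μ` relative to `O`. -/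
def IsMLTest {n : ℕ} (O : Set (ℕ →. ℕ)) (μ : Measure (OmegaSeq n)) (U : ℕ → Set (OmegaSeq n)) : Prop :=
  UniformSigma01 O U ∧ ∀ i, μ (U i) ≤ (2⁻¹ : ℝ≥0∞) ^ i

/-- The sequences that are Martin-Löf random for `μ` relative to `O`. -/
def MLRIn {n : ℕ} (O : Set (ℕ →. ℕ)) (μ : Measure (OmegaSeq n)) : Set (OmegaSeq n) :=
  {x | ∀ U, IsMLTest O μ U → x ∉ ⋂ i, U i}

/-- The `μ`-Martin-Löf random sequences. -/
def MLR {n : ℕ} (μ : Measure (OmegaSeq n)) : Set (OmegaSeq n) :=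
  MLRIn ∅ μ

/-- The sequences that are `μ`-Martin-Löf random relative to `z`. -/
def MLRRel {n m : ℕ} (z : OmegaSeq m) (μ : Measure (OmegaSeq n)) : Set (OmegaSeq n) :=
  MLRIn {z.oracle} μ

/-- The index of a binary string in the standard (length-lexicographic) enumeration
`σ₀ = ε, σ₁ = 0, σ₂ = 1, σ₃ = 00, σ₄ = 01, …`: if `σ = σ_i` then `σ0 = σ_(2i+1)` and
`σ1 = σ_(2i+2)`. -/
def stdIndex (σ : List (Fin 2)) : ℕ :=
  σ.foldl (fun i b => 2 * i + b + 1) 0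

/-- The label `ℓ_x(σ_i) = x_(i-1)` of a binary string; it is used only for `σ_i ≠ ε`,
that is, for `i ≥ 1`. -/
def label (x : OmegaSeq 3) (σ : List (Fin 2)) : Fin 3 :=
  x (stdIndex σ - 1)

/-- The sequence of labels `ℓ_x(y ↾ 1), ℓ_x(y ↾ 2), …` along `y`. -/
def pathLabel (x : OmegaSeq 3) (y : OmegaSeq 2) : OmegaSeq 3 :=
  fun k => label x (y.initSeg (k + 1))

/-- The letters `0` and `1` of the ternary alphabet, as letters of the binary one.
It is used only for `a ≠ 2`. -/
def toBit (a : Fin 3) : Fin 2 :=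
  if a = 1 then 1 else 0

/-- The partial operation of removing all letters `2` from a ternary sequence, defined when
infinitely many letters remain: the `j`-th letter of the result is the letter at the `j`-th
position that does not hold a `2`. -/
noncomputable def removeTwos : OmegaSeq 3 →. OmegaSeq 2 := fun s =>
  ⟨{k | s k ≠ 2}.Infinite, fun _ j => toBit (s (Nat.nth (fun k => s k ≠ 2) j))⟩

/-- The partial function `F_x : ⊆ 2^ω → 2^ω` coded by `x ∈ 3^ω`. -/
noncomputable def codedFun (x : OmegaSeq 3) : OmegaSeq 2 →. OmegaSeq 2 := fun y =>
  removeTwos (pathLabel x y)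

/-- A random continuous function is one with a Martin-Löf random code. (Every `F_x` is
continuous on its domain.) -/
def IsRandomContinuous (F : OmegaSeq 2 →. OmegaSeq 2) : Prop :=
  ∃ x ∈ MLR (lebesgue 3), F = codedFun x

/-! For random `x` the function is total: the expected number of paths of `n` letters 2 below a node
is (2/3)^n, so the existence of such paths for every `n` is caught by a Martin-Löf test. By
compactness of the binary tree, a sequence is then in the range as soon as arbitrarily long finite
paths agree with it. The range is thus the decreasing intersection of the clopen sets `coveredSet x
n 0` (`ran_codedFun`).

These sets are large. A fixed binary sequence fails to survive `n` steps with probability at most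
1/4 (`lebesgue_compl_survivalSet_le`). By Fubini and Markov, the cover has measure below 1/2 with
probability at most 1/2. A cover below 2^-(k+2) forces covers below 2^-(k+1) at both children, which
are independent, so the probability of a small cover is at most squared at each level
(`lebesgue_smallCoverSet_le`). Hence "some cover is below 2^-(k+1)" is a Martin-Löf test. A random
`x` passes it, and continuity from above gives the range positive measure.

Finally, there are only countably many tests relative to a given code, so the sequences random
relative to it have full measure and meet the range. -/

/-! ### Product measure and independence of disjoint sets of coordinates. -/

/-- The uniform measure on `n` letters. -/
noncomputable abbrev letterMeasure (n : ℕ) [NeZero n] : Measure (Fin n) :=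
  (PMF.uniformOfFintype (Fin n)).toMeasure

instance lebesgue_isProbabilityMeasure (n : ℕ) [NeZero n] : IsProbabilityMeasure (lebesgue n) := by
  unfold lebesgue; infer_instance

theorem letterMeasure_singleton (n : ℕ) [NeZero n] (a : Fin n) :
    letterMeasure n {a} = (n : ℝ≥0∞)⁻¹ := by
  rw [letterMeasure, PMF.toMeasure_apply_singleton _ _ (measurableSet_singleton a)]
  simp

open Classical in
theorem lebesgue_pi (n : ℕ) [NeZero n] (s : Finset ℕ) (t : ℕ → Set (Fin n)) :
    lebesgue n (Set.pi s t) = ∏ i ∈ s, letterMeasure n (t i) :=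
  Measure.infinitePi_pi _ fun _ _ => MeasurableSet.of_discrete

theorem lebesgue_eval (n : ℕ) [NeZero n] (m : ℕ) (a : Fin n) :
    lebesgue n {x | x m = a} = (n : ℝ≥0∞)⁻¹ := by
  have := lebesgue_pi n {m} fun _ => {a}
  rw [Finset.prod_singleton, letterMeasure_singleton] at this
  rw [← this]
  congr 1
  ext x
  simp

/-- The set `A` of sequences only depends on the entries with index in `D`. -/
def DependsOnSet {n : ℕ} (A : Set (OmegaSeq n)) (D : Set ℕ) : Prop :=
  ∀ x x' : OmegaSeq n, (∀ m ∈ D, x m = x' m) → (x ∈ A ↔ x' ∈ A)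

-- Splicing two independent samples along `D` gives a sample again; this reduces independence to a
-- product measure of a rectangle.
open Classical in
theorem lebesgue_map_piecewise (n : ℕ) [NeZero n] (D : Set ℕ) :
    ((lebesgue n).prod (lebesgue n)).map (fun q m => if m ∈ D then q.1 m else q.2 m) =
      lebesgue n := by
  have hm : Measurable fun (q : OmegaSeq n × OmegaSeq n) (m : ℕ) =>
      if m ∈ D then q.1 m else q.2 m := by
    refine measurable_pi_lambda _ fun m => ?_
    split_ifs
    · exact (measurable_pi_apply m).comp measurable_fst
    · exact (measurable_pi_apply m).comp measurable_snd
  refine Measure.eq_infinitePi _ fun s t ht => ?_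
  rw [Measure.map_apply hm (MeasurableSet.pi s.countable_toSet fun i _ => ht i)]
  have : (fun (q : OmegaSeq n × OmegaSeq n) (m : ℕ) => if m ∈ D then q.1 m else q.2 m) ⁻¹'
      Set.pi s t = (Set.pi (s.filter (· ∈ D) : Finset ℕ) t) ×ˢ
        (Set.pi (s.filter (· ∉ D) : Finset ℕ) t) := by
    ext q
    simp only [Set.mem_preimage, Set.mem_pi, Set.mem_prod, Finset.coe_filter, Set.mem_ofPred_eq,
      Finset.mem_coe]
    constructor
    · exact fun h => ⟨fun i hi => by simpa [hi.2] using h i hi.1,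
        fun i hi => by simpa [hi.2] using h i hi.1⟩
    · intro h i hi
      by_cases hD : i ∈ D
      · simpa [hD] using h.1 i ⟨hi, hD⟩
      · simpa [hD] using h.2 i ⟨hi, hD⟩
  rw [this, Measure.prod_prod, lebesgue_pi, lebesgue_pi, Finset.prod_filter_mul_prod_filter_not]

theorem lebesgue_inter_of_disjoint {n : ℕ} [NeZero n] {A B : Set (OmegaSeq n)} {D E : Set ℕ}
    (hA : MeasurableSet A) (hB : MeasurableSet B) (hAD : DependsOnSet A D)
    (hBE : DependsOnSet B E) (hDE : Disjoint D E) :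
    lebesgue n (A ∩ B) = lebesgue n A * lebesgue n B := by
  classical
  have hm : Measurable fun (q : OmegaSeq n × OmegaSeq n) (m : ℕ) =>
      if m ∈ D then q.1 m else q.2 m := by
    refine measurable_pi_lambda _ fun m => ?_
    split_ifs
    · exact (measurable_pi_apply m).comp measurable_fst
    · exact (measurable_pi_apply m).comp measurable_snd
  rw [← Measure.prod_prod]
  nth_rw 1 [← lebesgue_map_piecewise n D]
  rw [Measure.map_apply hm (hA.inter hB)]
  congr 1
  ext q
  rw [Set.mem_preimage, Set.mem_inter_iff, Set.mem_prod]
  refine and_congr (hAD _ _ fun m hmD => by simp [hmD]) (hBE _ _ fun m hmE => ?_)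
  simp [Set.disjoint_right.1 hDE hmE]

theorem DependsOnSet.compl {n : ℕ} {A : Set (OmegaSeq n)} {D : Set ℕ} (h : DependsOnSet A D) :
    DependsOnSet Aᶜ D := fun x x' hx => not_congr (h x x' hx)

theorem DependsOnSet.mono {n : ℕ} {A : Set (OmegaSeq n)} {D E : Set ℕ} (h : DependsOnSet A D)
    (hDE : D ⊆ E) : DependsOnSet A E := fun x x' hx => h x x' fun m hm => hx m (hDE hm)

/-! ### Finite paths that agree with a given sequence. -/

/-- The nodes of the binary tree are numbered so that the children of `i` are `2 * i + 1` and
`2 * i + 2`, and node `m + 1` carries the label `l m`. `Survives l c n i p` says that some path of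
`n` steps starting below node `i` has labels which, with the letters `2` removed, agree with
`c p, c (p + 1), …`. -/
def Survives (l c : ℕ → ℕ) : ℕ → ℕ → ℕ → Prop
  | 0, _, _ => True
  | n + 1, i, p => ∃ b : Fin 2, (l (2 * i + b) = 2 ∧ Survives l c n (2 * i + b + 1) p) ∨
      (l (2 * i + b) = c p ∧ Survives l c n (2 * i + b + 1) (p + 1))

namespace Survives

/-- The last descendant of `i` at depth `n` is node `2 ^ n * (i + 2) - 2`, so this prefix contains
every label consulted. The bound is computable, as the tests require. -/
theorem congr_labels_of_lt {l l' c : ℕ → ℕ} {n i p : ℕ}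
    (h : ∀ m < 2 ^ n * (i + 2), l m = l' m) : Survives l c n i p ↔ Survives l' c n i p := by
  induction n generalizing i p with
  | zero => simp [Survives]
  | succ n ih =>
    have h1 : 1 ≤ 2 ^ n := Nat.one_le_two_pow
    have key : ∀ b : Fin 2, l (2 * i + b) = l' (2 * i + b) ∧
        ∀ q, Survives l c n (2 * i + b + 1) q ↔ Survives l' c n (2 * i + b + 1) q := by
      intro b
      have hb := b.isLt
      refine ⟨h _ ?_, fun q => ih fun m hm => h m (hm.trans_le ?_)⟩
      · rw [pow_succ]; nlinarith
      · rw [pow_succ, mul_assoc]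
        exact Nat.mul_le_mul_left _ (by omega)
    simp only [Survives, key]

theorem congr_symbols {l c c' : ℕ → ℕ} {n i p : ℕ}
    (h : ∀ q, p ≤ q → q < p + n → c q = c' q) : Survives l c n i p ↔ Survives l c' n i p := by
  induction n generalizing i p with
  | zero => simp [Survives]
  | succ n ih =>
    have h1 := fun j => ih (i := j) (p := p) fun q h1 h2 => h q h1 (by omega)
    have h2 := fun j => ih (i := j) (p := p + 1) fun q h1 h2 => h q (by omega) (by omega)
    simp only [Survives, h1, h2, h p le_rfl (by omega)]

theorem shift_symbols {l c : ℕ → ℕ} {n i p : ℕ} :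
    Survives l c n i (p + 1) ↔ Survives l (fun q => c (q + 1)) n i p := by
  induction n generalizing i p with
  | zero => simp [Survives]
  | succ n ih => simp only [Survives, ih]

theorem of_succ {l c : ℕ → ℕ} {n i p : ℕ} (h : Survives l c (n + 1) i p) :
    Survives l c n i p := by
  induction n generalizing i p with
  | zero => trivial
  | succ n ih =>
    obtain ⟨b, h | h⟩ := h
    · exact ⟨b, .inl ⟨h.1, ih h.2⟩⟩
    · exact ⟨b, .inr ⟨h.1, ih h.2⟩⟩

theorem antitone {l c : ℕ → ℕ} {i p : ℕ} : Antitone fun n => Survives l c n i p :=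
  antitone_nat_of_succ_le fun _ => of_succ

theorem measurableSet {n : ℕ} {l c : OmegaSeq 3 × OmegaSeq 2 → ℕ → ℕ}
    (hl : ∀ m, Measurable fun q => l q m) (hc : ∀ m, Measurable fun q => c q m) (i p : ℕ) :
    MeasurableSet {q | Survives (l q) (c q) n i p} := by
  induction n generalizing i p with
  | zero => simp [Survives]
  | succ n ih =>
    simp only [Survives, Fin.exists_fin_two]
    have h : ∀ b : Fin 2, MeasurableSet {q |
        (l q (2 * i + b) = 2 ∧ Survives (l q) (c q) n (2 * i + b + 1) p) ∨
        (l q (2 * i + b) = c q p ∧ Survives (l q) (c q) n (2 * i + b + 1) (p + 1))} := fun b =>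
      ((measurableSet_eq_fun (hl _) measurable_const).inter (ih _ _)).union
        ((measurableSet_eq_fun (hl _) (hc _)).inter (ih _ _))
    exact (h 0).union (h 1)

end Survives

/-- The entries of a sequence, as natural numbers. -/
def OmegaSeq.toNatSeq {n : ℕ} (x : OmegaSeq n) : ℕ → ℕ := fun m => x m

/-! ### Subtrees and the coordinates they use. -/

/-- The indices of the labels of the proper descendants of node `i`. -/
def descendantLabels (i : ℕ) : Set ℕ := {m | ∃ k, (m + 2) / 2 ^ (k + 1) = i + 1}

/-- The indices of the labels of the child `2 * i + b + 1` of node `i` and of its descendants. -/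
def branchLabels (i : ℕ) (b : Fin 2) : Set ℕ := {m | ∃ k, (m + 2) / 2 ^ k = 2 * i + b + 2}

theorem branchLabels_subset (i : ℕ) (b : Fin 2) : branchLabels i b ⊆ descendantLabels i := by
  rintro m ⟨k, hk⟩
  refine ⟨k, ?_⟩
  rw [pow_succ, ← Nat.div_div_eq_div_mul, hk]
  omega

theorem self_mem_branchLabels (i : ℕ) (b : Fin 2) : 2 * i + (b : ℕ) ∈ branchLabels i b :=
  ⟨0, by simp⟩

theorem descendantLabels_subset_branchLabels (i : ℕ) (b : Fin 2) :
    descendantLabels (2 * i + b + 1) ⊆ branchLabels i b := by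
  rintro m ⟨k, hk⟩
  exact ⟨k + 1, hk⟩

/-- With node numbers shifted up by one, passing to the parent is halving, and label `m` sits at the
shifted node `m + 2`. Siblings cannot both be ancestors of one node: at the same level they would be
equal, and at different levels one would be at most half of the other. -/
theorem disjoint_branchLabels (i : ℕ) : Disjoint (branchLabels i 0) (branchLabels i 1) := by
  have key : ∀ (a b d : ℕ), a / 2 ^ (d + 1) = b → 2 * b ≤ a := by
    rintro a b d rfl
    have : a / 2 ^ (d + 1) ≤ a / 2 := Nat.div_le_div_left
      (Nat.le_self_pow (Nat.succ_ne_zero d) 2) two_pos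
    omega
  rw [Set.disjoint_left]
  rintro m ⟨k, hk⟩ ⟨j, hj⟩
  simp only [Fin.val_zero, Fin.val_one] at hk hj
  rcases lt_trichotomy k j with h | rfl | h
  · obtain ⟨d, rfl⟩ := Nat.exists_eq_add_of_lt h
    rw [add_assoc, pow_add, ← Nat.div_div_eq_div_mul, hk] at hj
    have := key _ _ _ hj
    omega
  · omega
  · obtain ⟨d, rfl⟩ := Nat.exists_eq_add_of_lt h
    rw [add_assoc, pow_add, ← Nat.div_div_eq_div_mul, hj] at hk
    have := key _ _ _ hk
    omega

theorem disjoint_singleton_descendantLabels (m : ℕ) :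
    Disjoint {m} (descendantLabels (m + 1)) := by
  rw [Set.disjoint_singleton_left]
  rintro ⟨k, hk⟩
  have : (m + 2) / 2 ^ (k + 1) < m + 2 :=
    Nat.div_lt_self (by omega) (Nat.one_lt_two_pow (Nat.succ_ne_zero k))
  omega

theorem Survives.congr_labels {l l' c : ℕ → ℕ} {n i p : ℕ}
    (h : ∀ m ∈ descendantLabels i, l m = l' m) : Survives l c n i p ↔ Survives l' c n i p := by
  induction n generalizing i p with
  | zero => simp [Survives]
  | succ n ih =>
    have key : ∀ b : Fin 2, l (2 * i + b) = l' (2 * i + b) ∧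
        ∀ q, Survives l c n (2 * i + b + 1) q ↔ Survives l' c n (2 * i + b + 1) q := fun b =>
      ⟨h _ (branchLabels_subset i b (self_mem_branchLabels i b)), fun q => ih fun m hm =>
        h m (branchLabels_subset i b (descendantLabels_subset_branchLabels i b hm))⟩
    simp only [Survives, key]

/-! ### Survival probability of a fixed sequence. -/

/-- The ternary label sequences for which `Survives` holds. -/
def survivalSet (c : ℕ → ℕ) (n i p : ℕ) : Set (OmegaSeq 3) :=
  {x | Survives x.toNatSeq c n i p}

/-- The contribution of the child `2 * i + b + 1` to `survivalSet c (n + 1) i p`. -/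
def branchSurvivalSet (c : ℕ → ℕ) (n i p : ℕ) (b : Fin 2) : Set (OmegaSeq 3) :=
  ({x | x.toNatSeq (2 * i + b) = 2} ∩ survivalSet c n (2 * i + b + 1) p) ∪
    ({x | x.toNatSeq (2 * i + b) = c p} ∩ survivalSet c n (2 * i + b + 1) (p + 1))

theorem survivalSet_succ (c : ℕ → ℕ) (n i p : ℕ) :
    survivalSet c (n + 1) i p = branchSurvivalSet c n i p 0 ∪ branchSurvivalSet c n i p 1 := by
  ext x
  exact Fin.exists_fin_two

theorem measurable_toNatSeq {n : ℕ} (m : ℕ) : Measurable fun x : OmegaSeq n => x.toNatSeq m :=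
  (measurable_of_finite fun a : Fin n => (a : ℕ)).comp (measurable_pi_apply m)

theorem measurableSet_survivalSet (c : ℕ → ℕ) (n i p : ℕ) :
    MeasurableSet (survivalSet c n i p) :=
  -- The binary coordinate is a dummy: the joint measurability result is sliced at a constant.
  (measurable_prodMk_right (y := (fun _ => 0 : OmegaSeq 2)))
    (Survives.measurableSet (l := fun q => q.1.toNatSeq) (c := fun _ => c)
      (fun m => (measurable_toNatSeq m).comp measurable_fst) (fun _ => measurable_const) i p)

theorem measurableSet_branchSurvivalSet (c : ℕ → ℕ) (n i p : ℕ) (b : Fin 2) :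
    MeasurableSet (branchSurvivalSet c n i p b) :=
  ((measurableSet_eq_fun (measurable_toNatSeq _) measurable_const).inter
    (measurableSet_survivalSet ..)).union
  ((measurableSet_eq_fun (measurable_toNatSeq _) measurable_const).inter
    (measurableSet_survivalSet ..))

theorem dependsOnSet_survivalSet (c : ℕ → ℕ) (n i p : ℕ) :
    DependsOnSet (survivalSet c n i p) (descendantLabels i) := fun _ _ h =>
  Survives.congr_labels fun m hm => congrArg Fin.val (h m hm)

theorem dependsOnSet_label (m a : ℕ) :
    DependsOnSet {x : OmegaSeq 3 | x.toNatSeq m = a} {m} := fun x x' h => by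
  simp [OmegaSeq.toNatSeq, h m rfl]

theorem dependsOnSet_branchSurvivalSet (c : ℕ → ℕ) (n i p : ℕ) (b : Fin 2) :
    DependsOnSet (branchSurvivalSet c n i p b) (branchLabels i b) := fun x x' h => by
  have h1 := fun a => dependsOnSet_label (2 * i + b) a x x' (by
    rintro m rfl; exact h _ (self_mem_branchLabels i b))
  have h2 := fun q => dependsOnSet_survivalSet c n (2 * i + b + 1) q x x' fun m hm =>
    h m (descendantLabels_subset_branchLabels i b hm)
  simp only [branchSurvivalSet, Set.mem_union, Set.mem_inter_iff, h1, h2]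

theorem lebesgue_label {m a : ℕ} (ha : a < 3) :
    lebesgue 3 {x | x.toNatSeq m = a} = 3⁻¹ := by
  have := lebesgue_eval 3 m ⟨a, ha⟩
  simp only [Fin.ext_iff] at this
  simpa [OmegaSeq.toNatSeq] using this

theorem lebesgue_label_inter_survivalSet {a : ℕ} (ha : a < 3) (c : ℕ → ℕ) (n m p : ℕ) :
    lebesgue 3 ({x | x.toNatSeq m = a} ∩ survivalSet c n (m + 1) p) =
      3⁻¹ * lebesgue 3 (survivalSet c n (m + 1) p) := by
  rw [lebesgue_inter_of_disjoint (measurableSet_eq_fun (measurable_toNatSeq _) measurable_const)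
    (measurableSet_survivalSet ..) (dependsOnSet_label m a) (dependsOnSet_survivalSet _ _ _ _)
    (disjoint_singleton_descendantLabels m), lebesgue_label ha]

/-- If no label matches any symbol, then only paths of letters `2` survive. -/
theorem lebesgue_survivalSet_le {c : ℕ → ℕ} (hc : ∀ p, 3 ≤ c p) (n i p : ℕ) :
    lebesgue 3 (survivalSet c n i p) ≤ (2 * 3⁻¹) ^ n := by
  induction n generalizing i p with
  | zero => simpa using prob_le_one
  | succ n ih =>
    have hb : ∀ b : Fin 2, lebesgue 3 (branchSurvivalSet c n i p b) ≤ 3⁻¹ * (2 * 3⁻¹) ^ n := by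
      intro b
      have : {x : OmegaSeq 3 | x.toNatSeq (2 * i + b) = c p} = ∅ := by
        ext x
        have h1 := (x (2 * i + b)).isLt
        have h2 := hc p
        simp only [OmegaSeq.toNatSeq, Set.mem_ofPred_eq, Set.mem_empty_iff_false, iff_false]
        omega
      rw [branchSurvivalSet, this, Set.empty_inter, Set.union_empty,
        lebesgue_label_inter_survivalSet (by norm_num)]
      gcongr
      exact ih _ _
    calc _ ≤ _ := by rw [survivalSet_succ]; exact measure_union_le _ _
      _ ≤ 3⁻¹ * (2 * 3⁻¹) ^ n + 3⁻¹ * (2 * 3⁻¹) ^ n := add_le_add (hb 0) (hb 1)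
      _ = _ := by ring

theorem lebesgue_branchSurvivalSet {c : ℕ → ℕ} {p : ℕ} (hc : c p < 2) (n i : ℕ) (b : Fin 2) :
    lebesgue 3 (branchSurvivalSet c n i p b) =
      3⁻¹ * lebesgue 3 (survivalSet c n (2 * i + b + 1) p) +
      3⁻¹ * lebesgue 3 (survivalSet c n (2 * i + b + 1) (p + 1)) := by
  rw [branchSurvivalSet, measure_union _ ((measurableSet_eq_fun (measurable_toNatSeq _)
    measurable_const).inter (measurableSet_survivalSet ..)),
    lebesgue_label_inter_survivalSet (by norm_num), lebesgue_label_inter_survivalSet (by omega)]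
  rw [Set.disjoint_left]
  rintro x ⟨h1, -⟩ ⟨h2, -⟩
  simp only [Set.mem_ofPred_eq] at h1 h2
  omega

/-- A child's label is useful (2 or the right bit) with probability 2/3, and the two children are
independent, so a bound `q` on failure passes to (1 - (2/3)(1 - q))^2. The constant 1/4 is the
smaller fixed point of this map. -/
theorem lebesgue_compl_survivalSet_le {c : ℕ → ℕ} (hc : ∀ p, c p < 2) (n i p : ℕ) :
    lebesgue 3 (survivalSet c n i p)ᶜ ≤ 4⁻¹ := by
  induction n generalizing i p with
  | zero => simp [survivalSet, Survives]
  | succ n ih =>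
    have hs : ∀ i p, 3 * 4⁻¹ ≤ lebesgue 3 (survivalSet c n i p) := by
      intro i p
      have h1 := prob_add_prob_compl (μ := lebesgue 3) (measurableSet_survivalSet c n i p)
      have h2 : lebesgue 3 (survivalSet c n i p) = 1 - lebesgue 3 (survivalSet c n i p)ᶜ :=
        ENNReal.eq_sub_of_add_eq (measure_ne_top _ _) h1
      rw [h2]
      calc (3 * 4⁻¹ : ℝ≥0∞) = 1 - 4⁻¹ := by
            refine ENNReal.eq_sub_of_add_eq (by simp) ?_
            rw [show (3 * 4⁻¹ + 4⁻¹ : ℝ≥0∞) = 4 * 4⁻¹ by ring]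
            exact ENNReal.mul_inv_cancel (by simp) (by simp)
        _ ≤ _ := tsub_le_tsub_left (ih i p) 1
    have hb : ∀ b : Fin 2, lebesgue 3 (branchSurvivalSet c n i p b)ᶜ ≤ 2⁻¹ := by
      intro b
      rw [prob_compl_eq_one_sub (measurableSet_branchSurvivalSet ..),
        lebesgue_branchSurvivalSet (hc p)]
      calc _ ≤ (1 : ℝ≥0∞) - (3⁻¹ * (3 * 4⁻¹) + 3⁻¹ * (3 * 4⁻¹)) :=
            tsub_le_tsub_left (add_le_add (mul_le_mul_right (hs _ _) _)
              (mul_le_mul_right (hs _ _) _)) 1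
        _ = 2⁻¹ := by
          rw [← mul_assoc, ENNReal.inv_mul_cancel (by simp) (by simp), one_mul, ← two_mul,
            show (4 : ℝ≥0∞) = 2 * 2 by norm_num, ENNReal.mul_inv (by simp) (by simp), ← mul_assoc,
            ENNReal.mul_inv_cancel (by simp) (by simp), one_mul, ENNReal.one_sub_inv_two]
    rw [survivalSet_succ, Set.compl_union, lebesgue_inter_of_disjoint
      (measurableSet_branchSurvivalSet ..).compl (measurableSet_branchSurvivalSet ..).compl
      (dependsOnSet_branchSurvivalSet _ _ _ _ _).compl (dependsOnSet_branchSurvivalSet _ _ _ _ _).compl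
      (disjoint_branchLabels i), show (4 : ℝ≥0∞) = 2 * 2 by norm_num,
      ENNReal.mul_inv (by simp) (by simp)]
    exact mul_le_mul' (hb 0) (hb 1)

/-! ### Measure of the covered sets. -/

/-- The binary sequences with which some path of `n` labels below node `i` agrees. -/
def coveredSet (x : OmegaSeq 3) (n i : ℕ) : Set (OmegaSeq 2) :=
  {z | Survives x.toNatSeq z.toNatSeq n i 0}

theorem measurableSet_prod_coveredSet (n i : ℕ) :
    MeasurableSet {q : OmegaSeq 3 × OmegaSeq 2 | q.2 ∈ coveredSet q.1 n i} :=
  Survives.measurableSet (l := fun q => q.1.toNatSeq) (c := fun q => q.2.toNatSeq)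
    (fun m => (measurable_toNatSeq m).comp measurable_fst)
    (fun m => (measurable_toNatSeq m).comp measurable_snd) i 0

theorem measurableSet_coveredSet (x : OmegaSeq 3) (n i : ℕ) : MeasurableSet (coveredSet x n i) :=
  measurable_prodMk_left (measurableSet_prod_coveredSet n i)

theorem measurable_lebesgue_coveredSet (n i : ℕ) :
    Measurable fun x => lebesgue 2 (coveredSet x n i) :=
  measurable_measure_prodMk_left (measurableSet_prod_coveredSet n i)

theorem coveredSet_antitone (x : OmegaSeq 3) (i : ℕ) : Antitone fun n => coveredSet x n i :=
  fun _ _ h _ hz => Survives.antitone h hz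

theorem lebesgue_map_tail (n : ℕ) [NeZero n] :
    (lebesgue n).map (fun z m => z (m + 1)) = lebesgue n := by
  have hm : Measurable fun (z : OmegaSeq n) m => z (m + 1) :=
    measurable_pi_lambda _ fun m => measurable_pi_apply _
  classical
  refine Measure.eq_infinitePi _ fun s t ht => ?_
  rw [Measure.map_apply hm (MeasurableSet.pi s.countable_toSet fun i _ => ht i)]
  have : (fun (z : OmegaSeq n) m => z (m + 1)) ⁻¹' Set.pi s t =
      Set.pi (s.map ⟨Nat.succ, Nat.succ_injective⟩ : Finset ℕ) fun m => t (m - 1) := by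
    ext z
    simp
  rw [this, lebesgue_pi, Finset.prod_map]
  simp

/-- If the child is labelled 2, its cover lies inside that of the parent. If it is labelled by a
bit, prefixing that bit maps its cover into the parent's and halves the measure. -/
theorem lebesgue_coveredSet_child_le (x : OmegaSeq 3) (n i : ℕ) (b : Fin 2) :
    lebesgue 2 (coveredSet x n (2 * i + b + 1)) ≤ 2 * lebesgue 2 (coveredSet x (n + 1) i) := by
  by_cases h2 : x.toNatSeq (2 * i + b) = 2
  · refine le_trans (measure_mono fun z hz => ?_) (le_mul_of_one_le_left' one_le_two)
    exact ⟨b, .inl ⟨h2, hz⟩⟩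
  have hlt : x.toNatSeq (2 * i + b) < 2 :=
    lt_of_le_of_ne (Nat.le_of_lt_succ (x (2 * i + b)).isLt) h2
  have hm : Measurable fun (z : OmegaSeq 2) m => z (m + 1) :=
    measurable_pi_lambda _ fun m => measurable_pi_apply _
  set A : Set (OmegaSeq 2) := {z | z 0 = ⟨_, hlt⟩} with hA
  set B : Set (OmegaSeq 2) := (fun z m => z (m + 1)) ⁻¹' coveredSet x n (2 * i + b + 1) with hB
  have hsub : A ∩ B ⊆ coveredSet x (n + 1) i := by
    rintro z ⟨hz1, hz2⟩
    refine ⟨b, .inr ⟨?_, Survives.shift_symbols.2 hz2⟩⟩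
    exact (congrArg Fin.val hz1).symm
  have hmeas : lebesgue 2 (A ∩ B) = 2⁻¹ * lebesgue 2 (coveredSet x n (2 * i + b + 1)) := by
    rw [lebesgue_inter_of_disjoint (D := {0}) (E := {0}ᶜ)
      (A := A) (B := B)
      (measurable_pi_apply 0 (measurableSet_singleton _)) (hm (measurableSet_coveredSet ..))
      (fun z z' h => by simp [A, h 0 rfl])
      (fun z z' h => by
        have : (fun m => z (m + 1)) = fun m => z' (m + 1) := funext fun m => h _ (by simp)
        simp [B, this])
      disjoint_compl_right, hA, lebesgue_eval, hB,
      ← Measure.map_apply hm (measurableSet_coveredSet ..), lebesgue_map_tail]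
    norm_num
  calc _ = 2 * (2⁻¹ * lebesgue 2 (coveredSet x n (2 * i + b + 1))) := by
        rw [← mul_assoc, ENNReal.mul_inv_cancel (by simp) (by simp), one_mul]
    _ ≤ _ := by rw [← hmeas]; gcongr

/-- The label sequences for which the set of sequences covered after `n` steps below node `i` has
measure less than `2⁻¹ ^ (k + 1)`. -/
def smallCoverSet (n i k : ℕ) : Set (OmegaSeq 3) :=
  {x | lebesgue 2 (coveredSet x n i) < 2⁻¹ ^ (k + 1)}

theorem measurableSet_smallCoverSet (n i k : ℕ) : MeasurableSet (smallCoverSet n i k) :=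
  measurableSet_lt (measurable_lebesgue_coveredSet n i) measurable_const

theorem dependsOnSet_smallCoverSet (n i k : ℕ) :
    DependsOnSet (smallCoverSet n i k) (descendantLabels i) := fun x x' h => by
  have : coveredSet x n i = coveredSet x' n i := Set.ext fun z =>
    Survives.congr_labels fun m hm => congrArg Fin.val (h m hm)
  simp [smallCoverSet, this]

/-- By Fubini the expected measure of the uncovered part is at most 1/4; Markov's inequality at
level 1/2 does the rest. -/
theorem lebesgue_smallCoverSet_zero_le (n i : ℕ) : lebesgue 3 (smallCoverSet n i 0) ≤ 2⁻¹ := by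
  have hS := (measurableSet_prod_coveredSet n i).compl
  set f : OmegaSeq 3 → ℝ≥0∞ := fun x => lebesgue 2 (coveredSet x n i)ᶜ with hf
  have hint : ∫⁻ x, f x ∂lebesgue 3 ≤ 4⁻¹ := by
    calc ∫⁻ x, f x ∂lebesgue 3 = ((lebesgue 3).prod (lebesgue 2))
          {q : OmegaSeq 3 × OmegaSeq 2 | q.2 ∈ coveredSet q.1 n i}ᶜ := (Measure.prod_apply hS).symm
      _ = ∫⁻ z, lebesgue 3 (survivalSet z.toNatSeq n i 0)ᶜ ∂lebesgue 2 :=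
          Measure.prod_apply_symm hS
      _ ≤ ∫⁻ _, 4⁻¹ ∂lebesgue 2 := lintegral_mono fun z =>
          lebesgue_compl_survivalSet_le (fun p => (z p).isLt) n i 0
      _ = 4⁻¹ := by simp
  have hmarkov := mul_meas_ge_le_lintegral₀ (μ := lebesgue 3) (f := f)
    (measurable_measure_prodMk_left hS).aemeasurable 2⁻¹
  have hsub : smallCoverSet n i 0 ⊆ {x | 2⁻¹ ≤ f x} := by
    intro x hx
    simp only [smallCoverSet, zero_add, pow_one, Set.mem_ofPred_eq] at hx
    simp only [Set.mem_ofPred_eq, hf]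
    rw [prob_compl_eq_one_sub (measurableSet_coveredSet ..)]
    calc (2⁻¹ : ℝ≥0∞) = 1 - 2⁻¹ := ENNReal.one_sub_inv_two.symm
      _ ≤ _ := tsub_le_tsub_left hx.le 1
  calc _ = 2 * (2⁻¹ * lebesgue 3 (smallCoverSet n i 0)) := by
        rw [← mul_assoc, ENNReal.mul_inv_cancel (by simp) (by simp), one_mul]
    _ ≤ 2 * 4⁻¹ := by
        gcongr
        exact (mul_le_mul_right (measure_mono hsub) _).trans (hmarkov.trans hint)
    _ = 2⁻¹ := by
        rw [show (4 : ℝ≥0∞) = 2 * 2 by norm_num, ENNReal.mul_inv (by simp) (by simp), ← mul_assoc,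
          ENNReal.mul_inv_cancel (by simp) (by simp), one_mul]

/-- A small cover at `i` makes both children's covers small at the next coarser threshold. These
events use disjoint subtrees, so the bound is squared, which is more than the factor 1/2 needed. -/
theorem lebesgue_smallCoverSet_le (n i k : ℕ) :
    lebesgue 3 (smallCoverSet n i k) ≤ 2⁻¹ ^ (k + 1) := by
  induction k generalizing n i with
  | zero => simpa using lebesgue_smallCoverSet_zero_le n i
  | succ k ih =>
    cases n with
    | zero =>
      have : smallCoverSet 0 i (k + 1) = ∅ := by
        ext x
        have : coveredSet x 0 i = Set.univ := Set.ext fun z => by simp [coveredSet, Survives]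
        simp only [smallCoverSet, this, measure_univ, Set.mem_ofPred_eq, Set.mem_empty_iff_false,
          iff_false, not_lt]
        exact pow_le_one₀ (by simp) (by simp)
      simp [this]
    | succ n =>
      have hsub : ∀ b : Fin 2,
          smallCoverSet (n + 1) i (k + 1) ⊆ smallCoverSet n (2 * i + b + 1) k := by
        intro b x hx
        calc lebesgue 2 (coveredSet x n (2 * i + b + 1))
            ≤ 2 * lebesgue 2 (coveredSet x (n + 1) i) := lebesgue_coveredSet_child_le x n i b
          _ < 2 * 2⁻¹ ^ (k + 1 + 1) :=
              ENNReal.mul_lt_mul_right (by simp) (by simp) hx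
          _ = 2⁻¹ ^ (k + 1) := by
              rw [pow_succ', ← mul_assoc, ENNReal.mul_inv_cancel (by simp) (by simp), one_mul]
      calc _ ≤ lebesgue 3 (smallCoverSet n (2 * i + (0 : Fin 2) + 1) k ∩
              smallCoverSet n (2 * i + (1 : Fin 2) + 1) k) :=
            measure_mono (Set.subset_inter (hsub 0) (hsub 1))
        _ = _ := lebesgue_inter_of_disjoint (measurableSet_smallCoverSet ..)
            (measurableSet_smallCoverSet ..)
            ((dependsOnSet_smallCoverSet _ _ _).mono (descendantLabels_subset_branchLabels i 0))
            ((dependsOnSet_smallCoverSet _ _ _).mono (descendantLabels_subset_branchLabels i 1))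
            (disjoint_branchLabels i)
        _ ≤ 2⁻¹ ^ (k + 1) * 2⁻¹ ^ (k + 1) := mul_le_mul' (ih _ _) (ih _ _)
        _ ≤ 2⁻¹ ^ (k + 1 + 1) := by
            rw [← pow_add]
            exact pow_le_pow_of_le_one (by simp) (by simp) (by omega)

/-! ### Computability of survival and of the measures of covers. -/

/-- One generation of the search for a surviving path, on a list of pairs of a node and a position
in the sequence of symbols. -/
def survivalStep (l c : ℕ → ℕ) (L : List (ℕ × ℕ)) : List (ℕ × ℕ) :=
  L.flatMap fun q => [0, 1].flatMap fun b =>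
    (if l (2 * q.1 + b) = 2 then [(2 * q.1 + b + 1, q.2)] else []) ++
    (if l (2 * q.1 + b) = c q.2 then [(2 * q.1 + b + 1, q.2 + 1)] else [])

/-- The recursion of `Survives` branches and changes its parameters; breadth-first search replaces
it by iteration of one list function, which is visibly primitive recursive. -/
theorem survivalStep_iterate_ne_nil (l c : ℕ → ℕ) (n : ℕ) (L : List (ℕ × ℕ)) :
    (survivalStep l c)^[n] L ≠ [] ↔ ∃ q ∈ L, Survives l c n q.1 q.2 := by
  induction n generalizing L with
  | zero => cases L <;> simp [Survives]
  | succ n ih =>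
    rw [Function.iterate_succ_apply, ih]
    simp only [survivalStep, Survives, Fin.exists_fin_two, List.mem_flatMap]
    constructor
    · rintro ⟨r, ⟨q, hq, b, hb, hr⟩, h⟩
      refine ⟨q, hq, ?_⟩
      simp only [List.mem_cons, List.not_mem_nil, or_false] at hb
      rw [List.mem_append] at hr
      rcases hb with rfl | rfl <;> rcases hr with hr | hr <;> split_ifs at hr with hl <;>
        simp only [List.mem_singleton, List.not_mem_nil] at hr <;> subst hr <;> simp_all
    · rintro ⟨q, hq, h⟩
      rcases h with (h | h) | (h | h)
      · exact ⟨(2 * q.1 + 0 + 1, q.2), ⟨q, hq, 0, by simp, by simp_all⟩, h.2⟩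
      · exact ⟨(2 * q.1 + 0 + 1, q.2 + 1), ⟨q, hq, 0, by simp, by simp_all⟩, h.2⟩
      · exact ⟨(2 * q.1 + 1 + 1, q.2), ⟨q, hq, 1, by simp, by simp_all⟩, h.2⟩
      · exact ⟨(2 * q.1 + 1 + 1, q.2 + 1), ⟨q, hq, 1, by simp, by simp_all⟩, h.2⟩

open Primrec in
theorem primrec_survivalStep {α : Type*} [Primcodable α] {l c : α → ℕ → ℕ} (hl : Primrec₂ l)
    (hc : Primrec₂ c) : Primrec₂ fun a => survivalStep (l a) (c a) := by
  have hA : Primrec fun r : ((α × List (ℕ × ℕ)) × (ℕ × ℕ)) × ℕ => r.1.1.1 :=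
    fst.comp (fst.comp fst)
  have hq1 : Primrec fun r : ((α × List (ℕ × ℕ)) × (ℕ × ℕ)) × ℕ => r.1.2.1 :=
    fst.comp (snd.comp fst)
  have hq2 : Primrec fun r : ((α × List (ℕ × ℕ)) × (ℕ × ℕ)) × ℕ => r.1.2.2 :=
    snd.comp (snd.comp fst)
  have hm : Primrec fun r : ((α × List (ℕ × ℕ)) × (ℕ × ℕ)) × ℕ => 2 * r.1.2.1 + r.2 :=
    nat_add.comp (nat_mul.comp (const 2) hq1) snd
  have hlm := hl.comp hA hm
  have h1 : Primrec fun r : ((α × List (ℕ × ℕ)) × (ℕ × ℕ)) × ℕ =>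
      if l r.1.1.1 (2 * r.1.2.1 + r.2) = 2 then [(2 * r.1.2.1 + r.2 + 1, r.1.2.2)] else [] :=
    ite (Primrec.eq.comp hlm (const 2)) (list_cons.comp ((succ.comp hm).pair hq2) (const []))
      (const [])
  have h2 : Primrec fun r : ((α × List (ℕ × ℕ)) × (ℕ × ℕ)) × ℕ =>
      if l r.1.1.1 (2 * r.1.2.1 + r.2) = c r.1.1.1 r.1.2.2 then
        [(2 * r.1.2.1 + r.2 + 1, r.1.2.2 + 1)] else [] :=
    ite (Primrec.eq.comp hlm (hc.comp hA hq2))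
      (list_cons.comp ((succ.comp hm).pair (succ.comp hq2)) (const [])) (const [])
  exact list_flatMap snd (list_flatMap (const [0, 1]) (list_append.comp h1 h2).to₂).to₂

open Primrec in
theorem primrecPred_survives {α : Type*} [Primcodable α] {l c : α → ℕ → ℕ} {n i p : α → ℕ}
    (hl : Primrec₂ l) (hc : Primrec₂ c) (hn : Primrec n) (hi : Primrec i) (hp : Primrec p) :
    PrimrecPred fun a => Survives (l a) (c a) (n a) (i a) (p a) := by
  have h : Primrec fun a => (survivalStep (l a) (c a))^[n a] [(i a, p a)] :=
    nat_iterate hn (list_cons.comp (hi.pair hp) (const [])) (primrec_survivalStep hl hc)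
  refine (Primrec.eq.comp h (const [])).not.of_eq fun a => ?_
  rw [← ne_eq, survivalStep_iterate_ne_nil]
  simp

open Primrec Classical in
theorem primrec_count {α : Type*} [Primcodable α] {P : α → ℕ → Prop} {N : α → ℕ}
    (hP : PrimrecRel P) (hN : Primrec N) : Primrec fun a => Nat.count (P a) (N a) := by
  have h := nat_rec' (f := N) (g := fun _ : α => 0)
    (h := fun a (q : ℕ × ℕ) => q.2 + if P a q.1 then 1 else 0) hN (const 0)
    (nat_add.comp (snd.comp snd)
      (ite (PrimrecRel.comp hP fst (fst.comp snd)) (const 1) (const 0)))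
  refine h.of_eq fun a => ?_
  induction N a with
  | zero => simp
  | succ k ih => rw [Nat.count_succ, ← ih]

/-- The binary digits of `s`, beginning with the least significant one. -/
def binaryDigits (s p : ℕ) : ℕ := s / 2 ^ p % 2

open Primrec in
theorem primrec_two_pow : Primrec fun n : ℕ => 2 ^ n := by
  refine (nat_rec₁ (f := fun _ k => 2 * k) 1 (nat_mul.comp (const 2) snd).to₂).of_eq fun n => ?_
  induction n with
  | zero => rfl
  | succ n ih => rw [pow_succ', ← ih]

open Primrec in
theorem primrec_binaryDigits : Primrec₂ binaryDigits :=
  nat_mod.comp (nat_div.comp fst (primrec_two_pow.comp snd)) (const 2)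

/-- A property of sequences of labels that is primitive recursive in an initial segment of
computable length defines an effectively open set. -/
theorem uniformSigma01_exists {m : ℕ} [NeZero m] (P : ℕ → ℕ → (ℕ → ℕ) → Prop) (B : ℕ → ℕ → ℕ)
    (hB : Primrec₂ B)
    (hP : PrimrecPred fun a : (ℕ × ℕ) × List (Fin m) =>
      P a.1.1 a.1.2 fun j => (a.2.map Fin.val).getD j 0)
    (hdep : ∀ k n l l', (∀ j < B k n, l j = l' j) → (P k n l ↔ P k n l')) :
    UniformSigma01 ∅ fun k => {x : OmegaSeq m | ∃ n, P k n x.toNatSeq} := by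
  classical
  -- Requiring the string to reach length `B` makes the default value 0 beyond its end irrelevant,
  -- so acceptance of the string settles `P` for all its extensions.
  refine ⟨fun a => ∃ n, B a.1 n ≤ a.2.length ∧
    P a.1 n fun j => (a.2.map Fin.val).getD j 0, ?_, fun k => ?_⟩
  · have hQ : PrimrecPred fun q : (ℕ × List (Fin m)) × ℕ => B q.1.1 q.2 ≤ q.1.2.length ∧
        P q.1.1 q.2 fun j => (q.1.2.map Fin.val).getD j 0 :=
      (Primrec.nat_le.comp (hB.comp (Primrec.fst.comp Primrec.fst) Primrec.snd)
        (Primrec.list_length.comp (Primrec.snd.comp Primrec.fst))).and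
      (hP.comp (((Primrec.fst.comp Primrec.fst).pair Primrec.snd).pair
        (Primrec.snd.comp Primrec.fst)))
    have hdec := hQ.decide.to_comp
    have hre : REPred fun a : ℕ × List (Fin m) => ∃ n, B a.1 n ≤ a.2.length ∧
        P a.1 n fun j => (a.2.map Fin.val).getD j 0 := by
      refine (Partrec.dom_re (Partrec.rfind (p := fun a n => Part.some (decide
        (B a.1 n ≤ a.2.length ∧ P a.1 n fun j => (a.2.map Fin.val).getD j 0)))
        hdec.partrec.to₂)).of_eq fun a => ?_
      refine Nat.rfind_dom.trans ?_
      simp only [Part.mem_some_iff, Part.some_dom, implies_true, and_true, eq_comm (a := true),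
        decide_eq_true_eq]
    exact recursiveIn_empty_iff.2 hre
  · have hseg : ∀ (x : OmegaSeq m) (L j : ℕ), j < L →
        ((x.initSeg L).map Fin.val).getD j 0 = x.toNatSeq j := by
      intro x L j hj
      simp [OmegaSeq.initSeg, OmegaSeq.toNatSeq, List.getD, hj]
    ext x
    simp only [Set.mem_ofPred_eq, Set.mem_iUnion, cyl, exists_prop]
    constructor
    · rintro ⟨n, hn⟩
      have hlen : (x.initSeg (B k n)).length = B k n := by simp [OmegaSeq.initSeg]
      exact ⟨x.initSeg (B k n), ⟨n, hlen.ge, (hdep k n _ _ fun j hj => hseg x _ j hj).2 hn⟩,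
        by rw [hlen]⟩
    · rintro ⟨σ, ⟨n, hlen, hn⟩, hx⟩
      refine ⟨n, (hdep k n _ _ fun j hj => ?_).1 hn⟩
      rw [← hx]
      exact hseg x _ j (hj.trans_le hlen)

theorem binaryDigits_lt_two (s p : ℕ) : binaryDigits s p < 2 := Nat.mod_lt _ two_pos

theorem testBit_eq_binaryDigits (s p : ℕ) : s.testBit p = decide (binaryDigits s p = 1) := by
  rw [Nat.testBit_eq_decide_div_mod_eq, binaryDigits]

theorem eq_of_binaryDigits_eq {n s t : ℕ} (hs : s < 2 ^ n) (ht : t < 2 ^ n)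
    (h : ∀ p < n, binaryDigits s p = binaryDigits t p) : s = t := by
  refine Nat.eq_of_testBit_eq fun p => ?_
  rcases lt_or_ge p n with hp | hp
  · rw [testBit_eq_binaryDigits, testBit_eq_binaryDigits, h p hp]
  · have h2 := Nat.pow_le_pow_right two_pos hp
    rw [Nat.testBit_lt_two_pow (hs.trans_le h2), Nat.testBit_lt_two_pow (ht.trans_le h2)]

theorem exists_binaryDigits_eq (z : OmegaSeq 2) (n : ℕ) :
    ∃ s < 2 ^ n, ∀ p < n, binaryDigits s p = z.toNatSeq p := by
  refine ⟨Nat.ofBits fun p : Fin n => decide (z p = 1), Nat.ofBits_lt_two_pow _, fun p hp => ?_⟩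
  have h := Nat.testBit_ofBits_lt (fun p : Fin n => decide (z p = 1)) p hp
  have h1 := binaryDigits_lt_two (Nat.ofBits fun p : Fin n => decide (z p = 1)) p
  rw [testBit_eq_binaryDigits, decide_eq_decide] at h
  have h2 : z.toNatSeq p < 2 := (z p).isLt
  have h3 : z p = 1 ↔ z.toNatSeq p = 1 := Fin.ext_iff
  rw [h3] at h
  omega

-- Strings of length `n` are coded by the numbers below `2 ^ n`. This turns comparing measures into
-- comparing integers, which a test can compute.
open Classical in
theorem lebesgue_eq_count {n : ℕ} {Q : (ℕ → ℕ) → Prop}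
    (hQ : ∀ c c' : ℕ → ℕ, (∀ p < n, c p = c' p) → (Q c ↔ Q c')) :
    lebesgue 2 {z | Q z.toNatSeq} =
      (Nat.count (fun s => Q (binaryDigits s)) (2 ^ n) : ℕ) * 2⁻¹ ^ n := by
  set C : ℕ → Set (OmegaSeq 2) := fun s =>
    Set.pi (Finset.range n) fun p => {a : Fin 2 | (a : ℕ) = binaryDigits s p} with hC
  have hmem : ∀ s z, z ∈ C s ↔ ∀ p < n, z.toNatSeq p = binaryDigits s p := fun s z => by
    simp [hC, OmegaSeq.toNatSeq]
  have hU : {z : OmegaSeq 2 | Q z.toNatSeq} =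
      ⋃ s ∈ (Finset.range (2 ^ n)).filter fun s => Q (binaryDigits s), C s := by
    ext z
    simp only [Set.mem_ofPred_eq, Set.mem_iUnion, hmem, Finset.mem_filter, Finset.mem_range,
      exists_prop]
    constructor
    · intro hz
      obtain ⟨s, hs, h⟩ := exists_binaryDigits_eq z n
      exact ⟨s, ⟨hs, (hQ _ _ h).2 hz⟩, fun p hp => (h p hp).symm⟩
    · rintro ⟨s, ⟨-, hs⟩, h⟩
      exact (hQ _ _ h).2 hs
  have hCm : ∀ s, lebesgue 2 (C s) = 2⁻¹ ^ n := fun s => by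
    rw [hC, lebesgue_pi]
    have : ∀ p, {a : Fin 2 | (a : ℕ) = binaryDigits s p} =
        {⟨binaryDigits s p, binaryDigits_lt_two s p⟩} := fun p => by
      ext a
      simp [Fin.ext_iff]
    simp only [this, letterMeasure_singleton]
    simp
  rw [hU, measure_biUnion_finset]
  · simp only [hCm, Finset.sum_const, nsmul_eq_mul, Nat.count_eq_card_filter_range]
  · intro s hs t ht hst
    simp only [Finset.coe_filter, Finset.mem_range, Set.mem_ofPred_eq] at hs ht
    refine Set.disjoint_left.2 fun z hz hz' => hst (eq_of_binaryDigits_eq hs.1 ht.1 fun p hp => ?_)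
    rw [← (hmem s z).1 hz p hp, (hmem t z).1 hz' p hp]
  · exact fun s _ => MeasurableSet.pi (Finset.countable_toSet _) fun _ _ => MeasurableSet.of_discrete

/-! ### The two Martin-Löf tests. -/

open Primrec in
theorem primrec₂_list_letters {m : ℕ} :
    Primrec₂ fun (a : (ℕ × ℕ) × List (Fin m)) j => (a.2.map Fin.val).getD j 0 :=
  (list_getD 0).comp (list_map (snd.comp fst) (fin_val.comp snd).to₂) snd

open Primrec in
/-- Below each node, the paths of letters `2` in a random label sequence have bounded length. -/
theorem exists_not_survives_of_mem_MLR {x : OmegaSeq 3} (hx : x ∈ MLR (lebesgue 3)) (t : ℕ) :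
    ∃ n, ¬ Survives x.toNatSeq (fun _ => 3) n t 0 := by
  by_contra! h
  -- The symbol 3 matches no label, so only letters 2 survive. Depth `2 * k` is used because (2/3)^2
  -- = 4/9 is at most 1/2.
  have hU := uniformSigma01_exists (m := 3) (fun k _ l => Survives l (fun _ => 3) (2 * k) t 0)
    (fun k _ => 2 ^ (2 * k) * (t + 2))
    (nat_mul.comp (primrec_two_pow.comp (nat_mul.comp (const 2) fst)) (const _))
    (primrecPred_survives primrec₂_list_letters (Primrec₂.const 3)
      (nat_mul.comp (const 2) (fst.comp fst)) (const t) (const 0))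
    (fun k _ l l' hl => Survives.congr_labels_of_lt hl)
  refine hx _ ⟨hU, fun k => ?_⟩ (Set.mem_iInter.2 fun k => ⟨0, h _⟩)
  have hset : {x : OmegaSeq 3 | ∃ _ : ℕ, Survives x.toNatSeq (fun _ => 3) (2 * k) t 0} =
      survivalSet (fun _ => 3) (2 * k) t 0 := by
    ext x
    simp [survivalSet]
  rw [hset]
  refine (lebesgue_survivalSet_le (fun _ => le_rfl) _ _ _).trans ?_
  rw [pow_mul]
  gcongr
  have h1 : (2 * 3⁻¹ : ℝ≥0∞) = ENNReal.ofReal (2 / 3) := by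
    rw [ENNReal.ofReal_div_of_pos (by norm_num)]
    simp [div_eq_mul_inv]
  have h2 : (2⁻¹ : ℝ≥0∞) = ENNReal.ofReal (1 / 2) := by
    rw [ENNReal.ofReal_div_of_pos (by norm_num)]
    simp
  rw [h1, h2, ← ENNReal.ofReal_pow (by norm_num)]
  exact ENNReal.ofReal_le_ofReal (by norm_num)

open Classical in
theorem lebesgue_coveredSet_eq_count (x : OmegaSeq 3) (n : ℕ) :
    lebesgue 2 (coveredSet x n 0) =
      (Nat.count (fun s => Survives x.toNatSeq (binaryDigits s) n 0 0) (2 ^ n) : ℕ) * 2⁻¹ ^ n :=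
  lebesgue_eq_count (Q := fun c => Survives x.toNatSeq c n 0 0) fun _ _ h =>
    Survives.congr_symbols fun q _ hq => h q (by omega)

theorem natCast_mul_inv_two_pow_lt_iff (a n k : ℕ) :
    (a : ℝ≥0∞) * 2⁻¹ ^ n < 2⁻¹ ^ k ↔ 2 ^ k * a < 2 ^ n := by
  rw [← ENNReal.inv_pow, ← ENNReal.inv_pow, ← div_eq_mul_inv, ENNReal.div_lt_iff (by simp) (by simp),
    mul_comm, ← div_eq_mul_inv, ENNReal.lt_div_iff_mul_lt (by simp) (by simp), mul_comm]
  exact_mod_cast Iff.rfl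

open Primrec Classical in
/-- The sets covered by a random label sequence have measure bounded away from zero. -/
theorem exists_le_lebesgue_coveredSet {x : OmegaSeq 3} (hx : x ∈ MLR (lebesgue 3)) :
    ∃ k, ∀ n, 2⁻¹ ^ (k + 1) ≤ lebesgue 2 (coveredSet x n 0) := by
  by_contra! h
  have hU := uniformSigma01_exists (m := 3) (fun k n l => 2 ^ (k + 1) *
      Nat.count (fun s => Survives l (binaryDigits s) n 0 0) (2 ^ n) < 2 ^ n)
    (fun _ n => 2 ^ n * (0 + 2))
    (nat_mul.comp (primrec_two_pow.comp snd) (const _))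
    (nat_lt.comp (nat_mul.comp (primrec_two_pow.comp (succ.comp (fst.comp fst)))
      (primrec_count (PrimrecPred.primrecRel (primrecPred_survives
        (α := ((ℕ × ℕ) × List (Fin 3)) × ℕ)
        (l := fun q j => (q.1.2.map Fin.val).getD j 0) (c := fun q => binaryDigits q.2)
        (n := fun q => q.1.1.2)
        (primrec₂_list_letters.comp (fst.comp fst) snd) (primrec_binaryDigits.comp (snd.comp fst) snd)
        (snd.comp (fst.comp fst)) (const 0) (const 0)))
        (primrec_two_pow.comp (snd.comp fst))))
      (primrec_two_pow.comp (snd.comp fst)))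
    (fun k n l l' hl => by simp only [Survives.congr_labels_of_lt hl])
  have hset : ∀ k, {x : OmegaSeq 3 | ∃ n, 2 ^ (k + 1) * Nat.count (fun s =>
      Survives x.toNatSeq (binaryDigits s) n 0 0) (2 ^ n) < 2 ^ n} =
      ⋃ n, smallCoverSet n 0 k := by
    intro k
    ext x
    simp only [Set.mem_iUnion, smallCoverSet, Set.mem_ofPred_eq, lebesgue_coveredSet_eq_count,
      natCast_mul_inv_two_pow_lt_iff]
  simp only [hset] at hU
  refine hx _ ⟨hU, fun k => ?_⟩ (Set.mem_iInter.2 fun k => Set.mem_iUnion.2 (h k))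
  -- Covers shrink as `n` grows, so these events increase and their union has the supremum of their
  -- measures: the bound uniform in `n` suffices.
  have hmono : Monotone fun n => smallCoverSet n 0 k := fun a b hab y hy =>
    (measure_mono (coveredSet_antitone y 0 hab)).trans_lt hy
  rw [hmono.measure_iUnion]
  exact iSup_le fun n => (lebesgue_smallCoverSet_le n 0 k).trans
    (pow_le_pow_of_le_one (by simp) (by simp) (Nat.le_succ k))

/-! ### The range as an intersection of covered sets. -/

theorem stdIndex_initSeg_succ (y : OmegaSeq 2) (k : ℕ) :
    stdIndex (y.initSeg (k + 1)) = 2 * stdIndex (y.initSeg k) + y k + 1 := by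
  simp [stdIndex, OmegaSeq.initSeg, List.range_succ]

theorem pathLabel_apply (x : OmegaSeq 3) (y : OmegaSeq 2) (k : ℕ) :
    pathLabel x y k = x (2 * stdIndex (y.initSeg k) + y k) := by
  rw [pathLabel, label, stdIndex_initSeg_succ, Nat.add_sub_cancel]

theorem val_toBit {a : Fin 3} (ha : a ≠ 2) : (toBit a : ℕ) = a := by
  revert a
  decide

theorem mem_codedFun {x : OmegaSeq 3} {y z : OmegaSeq 2} :
    z ∈ codedFun x y ↔ {k | pathLabel x y k ≠ 2}.Infinite ∧
      ∀ j, toBit (pathLabel x y (Nat.nth (fun k => pathLabel x y k ≠ 2) j)) = z j := by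
  constructor
  · rintro ⟨h, rfl⟩
    exact ⟨h, fun j => rfl⟩
  · rintro ⟨h, hz⟩
    exact ⟨h, funext hz⟩

theorem survives_of_mem_codedFun {x : OmegaSeq 3} {y z : OmegaSeq 2} (h : z ∈ codedFun x y)
    (n k : ℕ) : Survives x.toNatSeq z.toNatSeq n (stdIndex (y.initSeg k))
      (Nat.count (fun k => pathLabel x y k ≠ 2) k) := by
  obtain ⟨-, hz⟩ := mem_codedFun.1 h
  induction n generalizing k with
  | zero => trivial
  | succ n ih =>
    have hn := ih (k + 1)
    rw [stdIndex_initSeg_succ, Nat.count_succ] at hn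
    refine ⟨y k, ?_⟩
    by_cases h2 : pathLabel x y k = 2
    · rw [if_neg (not_not.2 h2), add_zero] at hn
      exact .inl ⟨by rw [OmegaSeq.toNatSeq, ← pathLabel_apply x y k, h2]; rfl, hn⟩
    · rw [if_pos h2] at hn
      refine .inr ⟨?_, hn⟩
      have h1 := hz (Nat.count (fun k => pathLabel x y k ≠ 2) k)
      rw [Nat.nth_count (p := fun k => pathLabel x y k ≠ 2) h2] at h1
      rw [OmegaSeq.toNatSeq, OmegaSeq.toNatSeq, ← pathLabel_apply x y k, ← h1, val_toBit h2]

/-- The step of König's lemma: if every continuation died at some depth, then, there being finitely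
many and survival being antitone in depth, all would be dead at a common depth. -/
theorem Survives.exists_child {l c : ℕ → ℕ} {i p : ℕ} (h : ∀ n, Survives l c n i p) :
    ∃ b : Fin 2, (l (2 * i + b) = 2 ∧ ∀ n, Survives l c n (2 * i + b + 1) p) ∨
      (l (2 * i + b) = c p ∧ ∀ n, Survives l c n (2 * i + b + 1) (p + 1)) := by
  by_contra! hcon
  have key : ∀ b : Fin 2, ∃ N, ¬ ((l (2 * i + b) = 2 ∧ Survives l c N (2 * i + b + 1) p) ∨
      (l (2 * i + b) = c p ∧ Survives l c N (2 * i + b + 1) (p + 1))) := by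
    intro b
    obtain ⟨h1, h2⟩ := hcon b
    by_cases hl : l (2 * i + b) = 2 <;> by_cases hr : l (2 * i + b) = c p
    · obtain ⟨N, hN⟩ := h1 hl
      obtain ⟨M, hM⟩ := h2 hr
      refine ⟨max N M, ?_⟩
      rintro (⟨-, h⟩ | ⟨-, h⟩)
      · exact hN (Survives.antitone (le_max_left N M) h)
      · exact hM (Survives.antitone (le_max_right N M) h)
    · obtain ⟨N, hN⟩ := h1 hl
      exact ⟨N, by tauto⟩
    · obtain ⟨M, hM⟩ := h2 hr
      exact ⟨M, by tauto⟩
    · exact ⟨0, by tauto⟩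
  choose N hN using key
  -- The sum is a common upper bound for both depths; the extra 1 pays for the step to the child.
  obtain ⟨b, hb⟩ := h (N 0 + N 1 + 1)
  have hle : N b ≤ N 0 + N 1 := by
    fin_cases b
    · exact Nat.le_add_right _ _
    · exact Nat.le_add_left _ _
  exact hN b (hb.imp (fun h => ⟨h.1, Survives.antitone hle h.2⟩)
    fun h => ⟨h.1, Survives.antitone hle h.2⟩)

/-- If finite paths of arbitrary length agree with `z`, then so does an infinite one. -/
theorem exists_path_of_survives {x : OmegaSeq 3} {z : OmegaSeq 2}
    (h : ∀ n, Survives x.toNatSeq z.toNatSeq n 0 0) :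
    ∃ y : OmegaSeq 2, ∀ k, pathLabel x y k ≠ 2 →
      (pathLabel x y k : ℕ) = z (Nat.count (fun k => pathLabel x y k ≠ 2) k) := by
  have hstep : ∀ q : {q : ℕ × ℕ // ∀ n, Survives x.toNatSeq z.toNatSeq n q.1 q.2},
      ∃ (b : Fin 2) (r : {q : ℕ × ℕ // ∀ n, Survives x.toNatSeq z.toNatSeq n q.1 q.2}),
        r.1.1 = 2 * q.1.1 + b + 1 ∧ ((x.toNatSeq (2 * q.1.1 + b) = 2 ∧ r.1.2 = q.1.2) ∨
          (x.toNatSeq (2 * q.1.1 + b) = z.toNatSeq q.1.2 ∧ r.1.2 = q.1.2 + 1)) := by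
    rintro ⟨q, hq⟩
    obtain ⟨b, hb | hb⟩ := Survives.exists_child hq
    · exact ⟨b, ⟨(_, _), hb.2⟩, rfl, .inl ⟨hb.1, rfl⟩⟩
    · exact ⟨b, ⟨(_, _), hb.2⟩, rfl, .inr ⟨hb.1, rfl⟩⟩
  choose b r hr1 hr2 using hstep
  set st : ℕ → {q : ℕ × ℕ // ∀ n, Survives x.toNatSeq z.toNatSeq n q.1 q.2} :=
    fun k => r^[k] ⟨(0, 0), h⟩
  have hst_succ : ∀ k, st (k + 1) = r (st k) := fun k => Function.iterate_succ_apply' _ _ _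
  set y : OmegaSeq 2 := fun k => b (st k)
  have hnode : ∀ k, stdIndex (y.initSeg k) = (st k).1.1 := by
    intro k
    induction k with
    | zero => rfl
    | succ k ih => rw [stdIndex_initSeg_succ, hst_succ, hr1, ih]
  have hlab : ∀ k, x.toNatSeq (2 * (st k).1.1 + b (st k)) = (pathLabel x y k : ℕ) := fun k => by
    rw [pathLabel_apply, hnode]; rfl
  have hz : ∀ k, z.toNatSeq k < 2 := fun k => (z k).isLt
  -- The position moves exactly at labels other than 2, since a label that matches a bit of `z`
  -- cannot be 2.
  have hcount : ∀ k, Nat.count (fun k => pathLabel x y k ≠ 2) k = (st k).1.2 := by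
    intro k
    induction k with
    | zero => rfl
    | succ k ih =>
      rw [Nat.count_succ, hst_succ, ih]
      rcases hr2 (st k) with ⟨h1, h2⟩ | ⟨h1, h2⟩
      · rw [hlab] at h1
        rw [if_neg (not_not.2 (Fin.ext h1)), h2, add_zero]
      · rw [hlab] at h1
        have : pathLabel x y k ≠ 2 := fun h' => by
          have h3 := hz (st k).1.2
          rw [← h1, h'] at h3
          exact absurd h3 (by decide)
        rw [if_pos this, h2]
  refine ⟨y, fun k hk => ?_⟩
  rw [hcount]
  rcases hr2 (st k) with ⟨h1, -⟩ | ⟨h1, -⟩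
  · rw [hlab] at h1
    exact absurd (Fin.ext h1) hk
  · rw [hlab] at h1
    exact h1

/-- A function with a random code is total. -/
theorem infinite_pathLabel_ne_two {x : OmegaSeq 3} (hx : x ∈ MLR (lebesgue 3)) (y : OmegaSeq 2) :
    {k | pathLabel x y k ≠ 2}.Infinite := by
  intro hfin
  obtain ⟨K, hK⟩ := hfin.bddAbove
  have h2 : ∀ k, K + 1 ≤ k → pathLabel x y k = 2 := fun k hk => by
    by_contra hne
    have : k ≤ K := hK hne
    omega
  -- Beyond its last letter other than 2, `y` itself would be an unbounded path of letters 2 below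
  -- this node.
  obtain ⟨n, hn⟩ := exists_not_survives_of_mem_MLR hx (stdIndex (y.initSeg (K + 1)))
  refine hn ?_
  have key : ∀ n k, K + 1 ≤ k →
      Survives x.toNatSeq (fun _ => 3) n (stdIndex (y.initSeg k)) 0 := by
    intro n
    induction n with
    | zero => exact fun _ _ => trivial
    | succ n ih =>
      intro k hk
      have := ih (k + 1) (by omega)
      rw [stdIndex_initSeg_succ] at this
      exact ⟨y k, .inl ⟨by rw [OmegaSeq.toNatSeq, ← pathLabel_apply x y k, h2 k hk]; rfl, this⟩⟩
  exact key n _ le_rfl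

/-- Compactness alone yields a path whose letters agree with `z` but may be finitely many; totality
excludes this, so the output is all of `z`. -/
theorem ran_codedFun {x : OmegaSeq 3} (hx : x ∈ MLR (lebesgue 3)) :
    (codedFun x).ran = ⋂ n, coveredSet x n 0 := by
  ext z
  rw [Set.mem_iInter]
  constructor
  · rintro ⟨y, hy⟩ n
    exact survives_of_mem_codedFun hy n 0
  · intro h
    obtain ⟨y, hy⟩ := exists_path_of_survives h
    have hinf := infinite_pathLabel_ne_two hx y
    refine ⟨y, mem_codedFun.2 ⟨hinf, fun j => Fin.ext ?_⟩⟩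
    have hne := Nat.nth_mem_of_infinite hinf j
    rw [val_toBit hne, hy _ hne, Nat.count_nth_of_infinite hinf]

theorem measurableSet_ran_codedFun {x : OmegaSeq 3} (hx : x ∈ MLR (lebesgue 3)) :
    MeasurableSet (codedFun x).ran := by
  rw [ran_codedFun hx]
  exact MeasurableSet.iInter fun n => measurableSet_coveredSet x n 0

theorem lebesgue_ran_codedFun_pos {x : OmegaSeq 3} (hx : x ∈ MLR (lebesgue 3)) :
    0 < lebesgue 2 (codedFun x).ran := by
  obtain ⟨k, hk⟩ := exists_le_lebesgue_coveredSet hx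
  rw [ran_codedFun hx, (coveredSet_antitone x 0).measure_iInter
    (fun n => (measurableSet_coveredSet x n 0).nullMeasurableSet) ⟨0, measure_ne_top _ _⟩]
  exact lt_of_lt_of_le (ENNReal.pow_pos (by simp) _) (le_iInf hk)

/-! ### Countably many relative tests. -/

/-- One round of closing a set of partial functions under the operations that generate
`Nat.RecursiveIn`. -/
def recursiveStep (S : Set (ℕ →. ℕ)) : Set (ℕ →. ℕ) :=
  S ∪ Set.image2 (fun (f h : ℕ →. ℕ) (n : ℕ) => (Nat.pair <$> f n <*> h n : Part ℕ)) S S ∪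
    Set.image2 (fun (f h : ℕ →. ℕ) (n : ℕ) => (h n >>= f : Part ℕ)) S S ∪
    Set.image2 (fun (f h : ℕ →. ℕ) (p : ℕ) =>
      let (a, n) := Nat.unpair p
      (n.rec (f a) fun y IH => do
        let i ← IH
        h (Nat.pair a (Nat.pair y i)) : Part ℕ)) S S ∪
    (fun (f : ℕ →. ℕ) (a : ℕ) =>
      Nat.rfind fun n => (fun m => decide (m = 0)) <$> f (Nat.pair a n)) '' S

theorem countable_recursiveStep {S : Set (ℕ →. ℕ)} (hS : S.Countable) :
    (recursiveStep S).Countable :=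
  ((((hS.union (hS.image2 hS _)).union (hS.image2 hS _)).union (hS.image2 hS _)).union
    (hS.image _))

/-- Every derivation is finite, so the class is exhausted by countably many rounds of closure
starting from a countable set, each of which preserves countability. -/
theorem countable_setOf_natRecursiveIn {O : Set (ℕ →. ℕ)} (hO : O.Countable) :
    {f | Nat.RecursiveIn O f}.Countable := by
  set S₀ : Set (ℕ →. ℕ) := O ∪ {fun _ => 0, (Nat.succ : ℕ →. ℕ),
    ((fun n => (Nat.unpair n).1 : ℕ → ℕ) : ℕ →. ℕ),
    ((fun n => (Nat.unpair n).2 : ℕ → ℕ) : ℕ →. ℕ)}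
  have hcount : ∀ n, (recursiveStep^[n] S₀).Countable := by
    intro n
    induction n with
    | zero => exact hO.union ((((Set.countable_singleton _).insert _).insert _).insert _)
    | succ n ih =>
      rw [Function.iterate_succ_apply']
      exact countable_recursiveStep ih
  have hmono : Monotone fun n => recursiveStep^[n] S₀ := by
    refine monotone_nat_of_le_succ fun n f hf => ?_
    simp only [Function.iterate_succ_apply']
    exact .inl (.inl (.inl (.inl hf)))
  refine (Set.countable_iUnion hcount).mono fun f hf => Set.mem_iUnion.2 ?_
  have hpair : ∀ {f h : ℕ →. ℕ}, (∃ n, f ∈ recursiveStep^[n] S₀) →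
      (∃ n, h ∈ recursiveStep^[n] S₀) →
      ∃ n, f ∈ recursiveStep^[n] S₀ ∧ h ∈ recursiveStep^[n] S₀ := by
    rintro f h ⟨n, hn⟩ ⟨m, hm⟩
    exact ⟨max n m, hmono (le_max_left n m) hn, hmono (le_max_right n m) hm⟩
  have hsucc : ∀ {f : ℕ →. ℕ} {n}, f ∈ recursiveStep (recursiveStep^[n] S₀) →
      ∃ n, f ∈ recursiveStep^[n] S₀ := fun {f n} h =>
    ⟨n + 1, by rwa [Function.iterate_succ_apply']⟩
  induction hf with
  | zero => exact ⟨0, .inr (.inl rfl)⟩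
  | succ => exact ⟨0, .inr (.inr (.inl rfl))⟩
  | left => exact ⟨0, .inr (.inr (.inr (.inl rfl)))⟩
  | right => exact ⟨0, .inr (.inr (.inr (.inr rfl)))⟩
  | oracle g hg => exact ⟨0, .inl hg⟩
  | pair _ _ ihf ihh =>
    obtain ⟨n, hf, hh⟩ := hpair ihf ihh
    exact hsucc (n := n) (.inl (.inl (.inl (.inr ⟨_, hf, _, hh, rfl⟩))))
  | comp _ _ ihf ihh =>
    obtain ⟨n, hf, hh⟩ := hpair ihf ihh
    exact hsucc (n := n) (.inl (.inl (.inr ⟨_, hf, _, hh, rfl⟩)))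
  | prec _ _ ihf ihh =>
    obtain ⟨n, hf, hh⟩ := hpair ihf ihh
    exact hsucc (n := n) (.inl (.inr ⟨_, hf, _, hh, rfl⟩))
  | rfind _ ih =>
    obtain ⟨n, hf⟩ := ih
    exact hsucc (n := n) (.inr ⟨_, hf, rfl⟩)

/-- A predicate is recovered from the domain of its semi-decision function on codes, so distinct
predicates have distinct functions. -/
theorem countable_setOf_REIn {α : Type*} [Primcodable α] {O : Set (ℕ →. ℕ)} (hO : O.Countable) :
    {p : α → Prop | REIn O p}.Countable := by
  let code : (α → Prop) → ℕ →. ℕ := fun p n => Part.bind (Encodable.decode (α := α) n) fun a =>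
    (Part.assert (p a) fun _ => Part.some ()).map Encodable.encode
  have hmaps : Set.MapsTo code {p | REIn O p} {f | Nat.RecursiveIn O f} := fun p hp => hp
  refine hmaps.countable_of_injOn (fun p _ q _ hpq => funext fun a => ?_)
    (countable_setOf_natRecursiveIn hO)
  have hdom : ∀ p : α → Prop, (code p (Encodable.encode a)).Dom = p a := fun p => by
    simp [code, Part.assert]
  rw [← hdom p, ← hdom q, hpq]

theorem lebesgue_compl_MLRIn {n : ℕ} {O : Set (ℕ →. ℕ)} (hO : O.Countable)
    (μ : Measure (OmegaSeq n)) : μ (MLRIn O μ)ᶜ = 0 := by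
  set T : Set (ℕ → Set (OmegaSeq n)) := {U | IsMLTest O μ U}
  have hTc : T.Countable := by
    refine ((countable_setOf_REIn hO).image fun (W : ℕ × List (Fin n) → Prop) i =>
      ⋃ σ ∈ {σ | W (i, σ)}, cyl σ).mono ?_
    rintro U ⟨⟨W, hW, hU⟩, -⟩
    exact ⟨W, hW, funext fun i => (hU i).symm⟩
  have hsub : (MLRIn O μ)ᶜ ⊆ ⋃ U ∈ T, ⋂ i, U i := by
    intro x hx
    simp only [MLRIn, Set.mem_compl_iff, Set.mem_ofPred_eq, not_forall, not_not] at hx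
    obtain ⟨U, hU, hxU⟩ := hx
    exact Set.mem_biUnion (show U ∈ T from hU) hxU
  refine measure_mono_null hsub ((measure_biUnion_null_iff hTc).2 fun U hU => ?_)
  refine nonpos_iff_eq_zero.1 (ge_of_tendsto'
    (ENNReal.tendsto_pow_atTop_nhds_zero_of_lt_one (ENNReal.inv_lt_one.2 ENNReal.one_lt_two))
    fun i => (measure_mono (Set.iInter_subset U i)).trans (hU.2 i))

theorem mainTheorem6 (F : OmegaSeq 2 →. OmegaSeq 2) (hF : IsRandomContinuous F) :
    MeasurableSet F.ran ∧ 0 < lebesgue 2 F.ran ∧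
      ∀ x : OmegaSeq 3, F = codedFun x → ∃ y ∈ F.ran, y ∈ MLRRel x (lebesgue 2) := by
  obtain ⟨x₀, hx₀, rfl⟩ := hF
  have hpos := lebesgue_ran_codedFun_pos hx₀
  refine ⟨measurableSet_ran_codedFun hx₀, hpos, fun x _ => ?_⟩
  -- Otherwise the range would lie in the null set of sequences that are not random relative to `x`.
  by_contra! h
  exact hpos.ne' (measure_mono_null (fun y hy => h y hy)
    (lebesgue_compl_MLRIn (Set.countable_singleton x.oracle) (lebesgue 2)))
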